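/- Let $k\ge 0$, $X_k=\{0,1\}^{\{0,1,\dots,k\}}$ and $X=\{0,1\}^{\mathbb Z}$. A probability measure $\mu_k$ on $X_k$ is locally translation invariant (LTI) if for all $A,A'\subset\{0,\dots,k\}$ with $A'$ a translate of $A$, the marginal of $\mu_k$ on $\{0,1\}^{A'}$ is the translate of its marginal on $\{0,1\}^{A}$. A TI extension of $\mu_k$ is a translation-invariant probability measure $\mu$ on $X$ with $\pi_k\mu=\mu_k$, where $\pi_j\mu$ denotes the marginal of $\mu$ on $X_j$. The total entropy of a translation-invariant probability measure $\mu$ on $X$ is $$S(\mu)=\lim_{j\to\infty}\Bigl(-\sum_{\eta\in X_j}(\pi_j\mu)(\eta)\log(\pi_j\mu)(\eta)\Bigr)\in[0,\infty].$$ Let $G_k$ be the binary de Bruijn graph: its vertices and edges are the binary strings of length $k$ and $k+1$ respectively, and the edge $\eta_0\eta_1\cdots\eta_k$ runs from $\eta_0\cdots\eta_{k-1}$ to $\eta_1\cdots\eta_k$ (for $k=0$: one vertex with two loops). A cycle in $G_k$ is a closed path $\mathcal C=(\eta^{(1)},\dots,\eta^{(p)})$ of $p\ge1$ edges with no repeated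 vertices (a loop is a cycle), and $\nu_{\mathcal C}$ is the probability measure on $X$ giving weight $1/p$ to each of the $p$ translates of the $p$-periodic configuration $\cdots\eta^{(p)}_0\eta^{(1)}_0\eta^{(2)}_0\cdots\eta^{(p)}_0\eta^{(1)}_0\cdots$ that consists of the first symbols of the edges of $\mathcal C$ traced repeatedly. **Theorem.** Let $\mu_k$ be an LTI probability measure on $X_k$. Then there are cycles $\mathcal C_0,\dots,\mathcal C_{2^k}$ in $G_k$ (not necessarily distinct) and coefficients $c_0,\dots,c_{2^k}\ge0$ with $\sum_{i=0}^{2^k}c_i=1$ such that $$\hat\mu=\sum_{i=0}^{2^k}c_i\,\nu_{\mathcal C_i}$$ is a TI extension of $\mu_k$ of minimal total entropy: $S(\hat\mu)<\infty$, and $S(\hat\mu)\le S(\mu)$ for every TI extension $\mu$ of $\mu_k$. -/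

import Mathlib

open MeasureTheory Filter Topology

namespace LTIExtension

noncomputable section

/-- Bi-infinite configurations, `X = {0,1}^ℤ`. -/
abbrev Config : Type := ℤ → Fin 2

/-- Configurations `η₀ η₁ … η_k` on the interval `{0,1,…,k}`, i.e. `X_k = {0,1}^{{0,…,k}}`. -/
abbrev LocalConfig (k : ℕ) : Type := Fin (k + 1) → Fin 2

/-- Translation of a configuration by `n`. -/
def shiftConfig (n : ℤ) (η : Config) : Config := fun i => η (i + n)

/-- A measure on `X` is translation invariant (TI). -/
def IsTI (μ : Measure Config) : Prop := ∀ n : ℤ, μ.map (shiftConfig n) = μ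

/-- Restriction of a configuration to the sites `{0,…,j}`. -/
def window (j : ℕ) (η : Config) : LocalConfig j := fun i => η ((i : ℕ) : ℤ)

/-- `π_j μ`, the marginal of `μ` on `X_j`. -/
def marginal (j : ℕ) (μ : Measure Config) : Measure (LocalConfig j) := μ.map (window j)

/-- A measure on `X_k` is locally translation invariant (LTI): for all subsets `A`, `A'` of
`{0,…,k}` with `A' = A + n`, the marginal on `A'` is the translate of the marginal on `A`.
Here `τ : A → {0,…,k}` is the translation by `n`, and `A'` is its range. -/
def IsLTI {k : ℕ} (μ : Measure (LocalConfig k)) : Prop :=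
  ∀ (n : ℤ) (A : Set (Fin (k + 1))) (τ : A → Fin (k + 1)),
    (∀ i : A, ((τ i : ℕ) : ℤ) = (((i : Fin (k + 1)) : ℕ) : ℤ) + n) →
      μ.map (fun η (i : A) => η (τ i)) = μ.map (fun η (i : A) => η i)

/-- `μ` is a translation-invariant extension of `μk`: a TI probability measure on `X` whose
marginal on `X_k` is `μk`. -/
structure IsTIExtension {k : ℕ} (μ : Measure Config) (μk : Measure (LocalConfig k)) : Prop where
  isProbabilityMeasure : IsProbabilityMeasure μ
  isTI : IsTI μ
  marginal_eq : marginal k μ = μk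

/-- Gibbs-Shannon entropy `-∑ μ(q) log μ(q)` of a measure on a finite set. -/
def entropy {Q : Type*} [Fintype Q] [MeasurableSpace Q] (μ : Measure Q) : ℝ :=
  -∑ q : Q, μ.real {q} * Real.log (μ.real {q})

/-- Total entropy `S(μ) = lim_{j → ∞} S(π_j μ)`, with values in `[0,∞]`. The limit exists for
every probability measure `μ`, see `tendsto_totalEntropy`. -/
def totalEntropy (μ : Measure Config) : ENNReal :=
  limUnder atTop fun j : ℕ => ENNReal.ofReal (entropy (marginal j μ))

/-! ### The binary de Bruijn graph `G_k`

The vertices are the binary strings of length `k`, the edges are the binary strings of length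
`k + 1`; the edge `aθb` runs from `aθ` to `θb`. -/

/-- Initial vertex of an edge of `G_k`: delete the last symbol. -/
def source {k : ℕ} (e : LocalConfig k) : Fin k → Fin 2 := fun i => e i.castSucc

/-- Final vertex of an edge of `G_k`: delete the first symbol. -/
def target {k : ℕ} (e : LocalConfig k) : Fin k → Fin 2 := fun i => e i.succ

/-- A closed path in `G_k`: a cyclic sequence of `length ≥ 1` edges, each of which ends where the
next one starts. -/
structure ClosedPath (k : ℕ) where
  length : ℕ
  length_pos : 0 < length
  edge : ZMod length → LocalConfig k
  target_eq : ∀ j, target (edge j) = source (edge (j + 1))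

/-- A cycle is a closed path with no repeated vertices (a loop is a cycle). -/
def ClosedPath.IsCycle {k : ℕ} (P : ClosedPath k) : Prop :=
  Function.Injective fun j => source (P.edge j)

/-- The periodic configuration obtained by tracing `P` repeatedly, recording the first symbol of
each edge. -/
def ClosedPath.config {k : ℕ} (P : ClosedPath k) : Config := fun i => P.edge (i : ZMod P.length) 0

/-- The measure `ν_P`, giving weight `1 / |P|` to each of the translates by `0, 1, …, |P| - 1` of
the periodic configuration of `P`. -/
def ClosedPath.measure {k : ℕ} (P : ClosedPath k) : Measure Config :=
  (P.length : ENNReal)⁻¹ •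
    ∑ n ∈ Finset.range P.length, Measure.dirac (shiftConfig (n : ℤ) P.config)

/-! ### The limit defining the total entropy exists -/

theorem measurable_window (j : ℕ) : Measurable (window j) :=
  measurable_pi_lambda _ fun _ => measurable_pi_apply _

theorem negMulLog_add_le {a b : ℝ} (ha : 0 ≤ a) (hb : 0 ≤ b) :
    -((a + b) * Real.log (a + b)) ≤ -(a * Real.log a) + -(b * Real.log b) := by
  have key : ∀ {x y : ℝ}, 0 ≤ x → 0 ≤ y → x * Real.log x ≤ x * Real.log (x + y) := by
    intro x y hx hy
    rcases hx.eq_or_lt with rfl | hx'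
    · simp
    · exact mul_le_mul_of_nonneg_left (Real.log_le_log hx' (by linarith)) hx
  have h1 := key ha hb
  have h2 := key hb ha
  rw [add_comm b a] at h2
  linarith [add_mul a b (Real.log (a + b))]

theorem marginal_real_eq (μ : Measure Config) [IsProbabilityMeasure μ] (j : ℕ)
    (η : LocalConfig j) :
    (marginal j μ).real {η} = (marginal (j + 1) μ).real {Fin.snoc η (0 : Fin 2)} +
      (marginal (j + 1) μ).real {Fin.snoc η (1 : Fin 2)} := by
  unfold marginal
  rw [map_measureReal_apply (measurable_window _) (measurableSet_singleton _),
    map_measureReal_apply (measurable_window _) (measurableSet_singleton _),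
    map_measureReal_apply (measurable_window _) (measurableSet_singleton _),
    ← measureReal_union]
  · congr 1
    ext ω
    simp only [Set.mem_preimage, Set.mem_singleton_iff, Set.mem_union]
    constructor
    · rintro rfl
      have h : ∀ b : Fin 2, ω ((j + 1 : ℕ) : ℤ) = b →
          window (j + 1) ω = (Fin.snoc (window j ω) b : LocalConfig (j + 1)) := by
        intro b hb
        ext i
        refine Fin.lastCases ?_ (fun i => ?_) i
        · simp [window, ← hb]
        · simp [window]
      have h2 : ∀ b : Fin 2, b = 0 ∨ b = 1 := by decide
      rcases h2 (ω ((j + 1 : ℕ) : ℤ)) with hb | hb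
      · exact Or.inl (h _ hb)
      · exact Or.inr (h _ hb)
    · have h : ∀ b : Fin 2, window (j + 1) ω = (Fin.snoc η b : LocalConfig (j + 1)) →
          window j ω = η := by
        intro b hb
        ext i
        have := congrFun hb i.castSucc
        simp [window] at this ⊢
        rw [this]
      rintro (hb | hb)
      · exact h _ hb
      · exact h _ hb
  · rw [Set.disjoint_left]
    intro ω h0 h1
    simp only [Set.mem_preimage, Set.mem_singleton_iff] at h0 h1
    have := congrFun (h0.symm.trans h1) (Fin.last (j + 1))
    simp at this
  · exact measurable_window _ (measurableSet_singleton _)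

theorem entropy_marginal_mono (μ : Measure Config) [IsProbabilityMeasure μ] :
    Monotone fun j => entropy (marginal j μ) := by
  refine monotone_nat_of_le_succ fun j => ?_
  unfold entropy
  rw [← Finset.sum_neg_distrib, ← Finset.sum_neg_distrib]
  rw [← (Fin.snocEquiv fun _ : Fin (j + 2) => Fin 2).sum_comp, Fintype.sum_prod_type,
    Finset.sum_comm]
  refine Finset.sum_le_sum fun η _ => ?_
  rw [Fin.sum_univ_two, marginal_real_eq]
  exact negMulLog_add_le measureReal_nonneg measureReal_nonneg

/-- The total entropy of a probability measure is a genuine limit. -/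
theorem tendsto_totalEntropy (μ : Measure Config) [IsProbabilityMeasure μ] :
    Tendsto (fun j : ℕ => ENNReal.ofReal (entropy (marginal j μ))) atTop (𝓝 (totalEntropy μ)) :=
  tendsto_nhds_limUnder
    ⟨_, tendsto_atTop_iSup (ENNReal.ofReal_mono.comp (entropy_marginal_mono μ))⟩

end

end LTIExtension

namespace LTIExtension

/-! ### Paths in the de Bruijn graph -/

/-! For a translation-invariant `μ`, monotone convergence turns the total entropy into the mean of
`-log μ{η}` (`IsTI.totalEntropy_eq`). Finite entropy therefore forces `μ` to be purely atomic.

Only finitely many atoms share a given mass, and translation permutes them. Whenever a cycle of this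
permutation passes through the same vertex of `G_k` twice, exchanging the continuations cuts it in
two. Repeating this yields a permutation whose cycles trace cycles of `G_k`
(`exists_perm_injOn_cycles_of_finite_fibers`). Letting each atom follow the new permutation keeps
the marginal on `X_k`, and can only merge atoms, so the entropy does not increase
(`exists_weights_of_totalEntropy_lt_top`).

What remains is to minimise a strictly concave function over a compact polytope of weights on
finitely many periodic configurations. A minimiser is an extreme point
(`eq_zero_of_isMinOn_weightEntropy`). The constraints fix a circulation, which is determined by `2 ^
k + 1` of its values (`IsCirculation.eq_zero`), so an extreme point charges at most that many orbits
(`exists_minimal_weights`). -/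

theorem window_shiftConfig_of_path {k : ℕ} {E : ℤ → LocalConfig k}
    (hE : ∀ n, target (E n) = source (E (n + 1))) (n : ℤ) :
    window k (shiftConfig n fun i => E i 0) = E n := by
  -- The overlap of consecutive edges moves each symbol one place to the left, so symbol `m` of an
  -- edge is the first symbol `m` edges later.
  have key : ∀ (m : ℕ) (hm : m < k + 1) (n : ℤ), E (m + n) 0 = E n ⟨m, hm⟩ := by
    intro m
    induction m with
    | zero => intro hm n; simp
    | succ m ih =>
      intro hm n
      have h1 := ih (by omega) (n + 1)
      have h2 := congrFun (hE n) ⟨m, by omega⟩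
      simp only [target, source, Fin.succ_mk, Fin.castSucc_mk] at h2
      rw [h2, ← h1]
      congr 1
      push_cast
      ring_nf
  funext i
  exact key i i.2 n

theorem ClosedPath.window_shiftConfig_config {k : ℕ} (P : ClosedPath k) (n : ℤ) :
    window k (shiftConfig n P.config) = P.edge (n : ZMod P.length) :=
  window_shiftConfig_of_path (E := fun i : ℤ => P.edge (i : ZMod P.length))
    (fun i => by simpa using P.target_eq (i : ZMod P.length)) n

/-- The closed path traced by a periodic point `a` of `g`, where `E` labels points by edges. -/
noncomputable def orbitPath {k : ℕ} {α : Type*} (g : α → α) (a : α) (ha : 0 < Function.minimalPeriod g a)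
    (E : α → LocalConfig k) (hE : ∀ b, target (E b) = source (E (g b))) : ClosedPath k where
  length := Function.minimalPeriod g a
  length_pos := ha
  edge j := E (g^[j.val] a)
  target_eq j := by
    have : NeZero (Function.minimalPeriod g a) := ⟨ha.ne'⟩
    rw [hE, ← Function.iterate_succ_apply' g, ← Function.iterate_mod_minimalPeriod_eq (n := j.val.succ)]
    rw [ZMod.val_add, ZMod.val_one_eq_one_mod]
    simp

theorem orbitPath_isCycle {k : ℕ} {α : Type*} (g : α → α) (a : α)
    (ha : 0 < Function.minimalPeriod g a)
    (E : α → LocalConfig k) (hE : ∀ b, target (E b) = source (E (g b)))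
    (hinj : ∀ m n, source (E (g^[m] a)) = source (E (g^[n] a)) → g^[m] a = g^[n] a) :
    (orbitPath g a ha E hE).IsCycle := by
  intro i j hij
  have : NeZero (Function.minimalPeriod g a) := ⟨ha.ne'⟩
  have h := hinj (ZMod.val (n := Function.minimalPeriod g a) i)
    (ZMod.val (n := Function.minimalPeriod g a) j) hij
  exact ZMod.val_injective (Function.minimalPeriod g a)
    (Function.iterate_injOn_Iio_minimalPeriod (ZMod.val_lt _) (ZMod.val_lt _) h)

/-! ### Circulations on the de Bruijn graph -/

/-- Inflow equals outflow at every vertex. -/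
def IsCirculation {k : ℕ} (f : LocalConfig k → ℝ) : Prop :=
  ∀ v : Fin k → Fin 2, ∑ e with source e = v, f e = ∑ e with target e = v, f e

theorem fin_two_cases (b : Fin 2) : b = 0 ∨ b = 1 := by
  revert b; decide

theorem IsCirculation.sub {k : ℕ} {f g : LocalConfig k → ℝ} (hf : IsCirculation f)
    (hg : IsCirculation g) : IsCirculation (f - g) := fun v => by
  simp [Finset.sum_sub_distrib, hf v, hg v]

/-- A circulation is determined by its values on the edges starting with `1` and on `0⋯0`. -/
theorem IsCirculation.eq_zero {k : ℕ} {f : LocalConfig k → ℝ} (hf : IsCirculation f)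
    (h1 : ∀ e, e 0 = 1 → f e = 0) (h0 : f 0 = 0) : f = 0 := by
  -- Balance the flow at the final vertex of `e`: the only other incoming edge starts with `1`, and
  -- every outgoing edge has its `1` one place further left.
  have key : ∀ (m : ℕ) (hm : m < k + 1) (e : LocalConfig k), e ⟨m, hm⟩ = 1 → f e = 0 := by
    intro m
    induction m with
    | zero => intro _ e he; exact h1 e he
    | succ m ih =>
      intro hm e he
      rcases fin_two_cases (e 0) with he0 | he0
      swap
      · exact h1 e he0
      have hv := hf (target e)
      rw [Finset.sum_eq_zero, Finset.sum_eq_single e] at hv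
      · exact hv.symm
      · intro e' he' hne
        simp only [Finset.mem_filter, Finset.mem_univ, true_and] at he'
        rcases fin_two_cases (e' 0) with h | h
        · refine absurd ?_ hne
          funext i
          refine Fin.cases ?_ (fun i => ?_) i
          · rw [h, he0]
          · exact congrFun he' i
        · exact h1 e' h
      · simp
      · intro e' he'
        simp only [Finset.mem_filter, Finset.mem_univ, true_and] at he'
        refine ih (by omega) e' ?_
        have := congrFun he' ⟨m, by omega⟩
        simp only [source, target, Fin.castSucc_mk, Fin.succ_mk] at this
        rw [this, he]
  funext e
  by_cases he : e = 0
  · rw [he, h0]; rfl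
  · obtain ⟨i, hi⟩ := Function.ne_iff.1 he
    rcases fin_two_cases (e i) with h | h
    · exact absurd h hi
    · exact key i i.2 e h

/-- A nonnegative nonzero circulation is positive along some cycle. -/
theorem IsCirculation.exists_cycle {k : ℕ} {f : LocalConfig k → ℝ} (hf : IsCirculation f)
    (hpos : ∀ e, 0 ≤ f e) {e₀ : LocalConfig k} (he₀ : 0 < f e₀) :
    ∃ C : ClosedPath k, C.IsCycle ∧ ∀ j, 0 < f (C.edge j) := by
  classical
  set Pos : (Fin k → Fin 2) → Prop := fun v => 0 < ∑ e with source e = v, f e with hPos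
  have hex : ∀ v, ∃ e : LocalConfig k, source e = v ∧ (Pos v → 0 < f e) := by
    intro v
    by_cases hv : Pos v
    · obtain ⟨e, he, hfe⟩ := Finset.exists_lt_of_sum_lt
        (s := Finset.univ.filter fun e : LocalConfig k => source e = v) (f := fun _ => (0 : ℝ))
        (g := f) (by simpa using hv)
      exact ⟨e, (Finset.mem_filter.1 he).2, fun _ => hfe⟩
    -- An arbitrary outgoing edge, only to make the successor map total.
    · refine ⟨(Fin.snoc v (0 : Fin 2) : LocalConfig k), ?_, fun h => absurd h hv⟩
      funext i
      simp [source]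
  choose s hs hsf using hex
  set g : (Fin k → Fin 2) → (Fin k → Fin 2) := fun v => target (s v) with hg
  have hstep : ∀ v, Pos v → Pos (g v) := by
    intro v hv
    simp only [hPos]
    rw [hf (g v)]
    exact Finset.sum_pos' (fun e _ => hpos e) ⟨s v, by simp [hg], hsf v hv⟩
  have hpos₀ : Pos (source e₀) := Finset.sum_pos' (fun e _ => hpos e) ⟨e₀, by simp, he₀⟩
  have hiter : ∀ v, Pos v → ∀ n, Pos (g^[n] v) := by
    intro v hv n
    induction n with
    | zero => exact hv
    | succ n ih => rw [Function.iterate_succ_apply']; exact hstep _ ih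
  -- Following positive edges never leaves the positive vertices; by finiteness the walk becomes
  -- periodic.
  obtain ⟨a, ha, hap⟩ : ∃ a, Pos a ∧ 0 < Function.minimalPeriod g a := by
    obtain ⟨m, n, hmn, h⟩ := Finite.exists_ne_map_eq_of_infinite fun n => g^[n] (source e₀)
    wlog hlt : m < n generalizing m n
    · exact this n m hmn.symm h.symm (by omega)
    refine ⟨g^[m] (source e₀), hiter _ hpos₀ m, ?_⟩
    refine Function.IsPeriodicPt.minimalPeriod_pos (n := n - m) (by omega) ?_
    change g^[n - m] _ = _
    rw [← Function.iterate_add_apply, Nat.sub_add_cancel hlt.le]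
    exact h.symm
  refine ⟨orbitPath g a hap s fun b => (hs (g b)).symm, orbitPath_isCycle _ _ _ _ _ ?_, ?_⟩
  · intro m n h
    simpa only [hs] using h
  · intro j
    exact hsf _ (hiter a ha _)

/-! ### Splitting the cycles of a permutation -/

/-- If `n` is the first time `σ` carries `i` to `j`, the swap sends the predecessor of `j` back to
`i`. The new cycle of `i` is thus `i, σ i, …, σ^(n-1) i`, which misses `j`. -/
theorem not_sameCycle_swap_mul {α : Type*} [DecidableEq α] [Finite α] {σ : Equiv.Perm α} {i j : α}
    (hij : i ≠ j) (h : σ.SameCycle i j) : ¬ (Equiv.swap i j * σ).SameCycle i j := by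
  have hex : ∃ n : ℕ, (σ ^ n) i = j := by
    obtain ⟨n, -, hn⟩ := h.exists_pow_eq'
    exact ⟨n, hn⟩
  classical
  set n := Nat.find hex with hn
  have hnj : (σ ^ n) i = j := Nat.find_spec hex
  have hmin : ∀ l < n, (σ ^ l) i ≠ j := fun l hl => Nat.find_min hex hl
  have hn0 : 0 < n := by
    rcases Nat.eq_zero_or_pos n with h0 | h0
    · rw [h0] at hnj; exact absurd hnj hij
    · exact h0
  have hni : ∀ l < n, 0 < l → (σ ^ l) i ≠ i := by
    intro l hl hl0 hli
    refine hmin (n - l) (by omega) ?_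
    rw [← hnj]
    conv_rhs => rw [← Nat.sub_add_cancel hl.le, pow_add, Equiv.Perm.mul_apply, hli]
  set τ := Equiv.swap i j * σ with hτ
  have hpow : ∀ l < n, (τ ^ l) i = (σ ^ l) i := by
    intro l
    induction l with
    | zero => intro _; rfl
    | succ l ih =>
      intro hl
      rw [pow_succ', Equiv.Perm.mul_apply, ih (by omega), hτ, Equiv.Perm.mul_apply,
        ← Equiv.Perm.mul_apply σ, ← pow_succ' σ]
      exact Equiv.swap_apply_of_ne_of_ne (hni _ hl (by omega)) (hmin _ hl)
  have hret : (τ ^ n) i = i := by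
    obtain ⟨l, hl⟩ : ∃ l, n = l + 1 := ⟨n - 1, by omega⟩
    rw [hl, pow_succ', Equiv.Perm.mul_apply, hpow l (by omega), hτ, Equiv.Perm.mul_apply,
        ← Equiv.Perm.mul_apply σ, ← pow_succ' σ, ← hl, hnj, Equiv.swap_apply_right]
  intro hs
  obtain ⟨m, -, hm⟩ := hs.exists_pow_eq'
  have h1 : (τ ^ m) i = (τ ^ (m % n)) i := by
    conv_lhs => rw [← Nat.mod_add_div m n, pow_add, Equiv.Perm.mul_apply, pow_mul]
    congr 1
    exact Equiv.Perm.pow_apply_eq_self_of_apply_eq_self hret _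
  rw [h1, hpow _ (Nat.mod_lt _ hn0)] at hm
  exact hmin _ (Nat.mod_lt _ hn0) hm

/-- The swap redirects arrows only between `i` and `j`, which already share a cycle, so the new
cycles refine the old ones. -/
theorem sameCycle_of_swap_mul {α : Type*} [DecidableEq α] [Finite α] {σ : Equiv.Perm α} {i j : α}
    (h : σ.SameCycle i j) {a b : α} (hab : (Equiv.swap i j * σ).SameCycle a b) :
    σ.SameCycle a b := by
  obtain ⟨n, -, rfl⟩ := hab.exists_pow_eq'
  clear hab
  induction n with
  | zero => exact Equiv.Perm.SameCycle.refl _ _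
  | succ n ih =>
    refine ih.trans ?_
    rw [pow_succ', Equiv.Perm.mul_apply]
    generalize ((Equiv.swap i j * σ) ^ n) a = x
    rw [Equiv.Perm.mul_apply]
    have hx : σ.SameCycle x (σ x) := ⟨1, by simp⟩
    rcases eq_or_ne (σ x) i with h1 | h1
    · rw [h1, Equiv.swap_apply_left]
      rw [h1] at hx
      exact hx.trans h
    rcases eq_or_ne (σ x) j with h2 | h2
    · rw [h2, Equiv.swap_apply_right]
      rw [h2] at hx
      exact hx.trans h.symm
    · rwa [Equiv.swap_apply_of_ne_of_ne h1 h2]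

/-- A permutation of a finite set can be rewired, without changing the `v`-label of the image of any
point, so that no cycle visits a label twice. -/
theorem exists_perm_injOn_cycles {α V : Type*} [Finite α] (s : Equiv.Perm α) (v : α → V) :
    ∃ σ : Equiv.Perm α, (∀ a, v (σ a) = v (s a)) ∧
      ∀ a b, σ.SameCycle a b → v a = v b → a = b := by
  classical
  have : Nonempty {σ : Equiv.Perm α // ∀ a, v (σ a) = v (s a)} := ⟨⟨s, fun _ => rfl⟩⟩
  -- Minimise the number of pairs sharing a cycle; splitting a cycle at a repeated label would lower
  -- it strictly.
  obtain ⟨⟨σ, hσ⟩, hmin⟩ := Finite.exists_min fun σ : {σ : Equiv.Perm α // ∀ a, v (σ a) = v (s a)} =>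
    {p : α × α | σ.1.SameCycle p.1 p.2}.ncard
  refine ⟨σ, hσ, fun i j hij hv => ?_⟩
  by_contra hne
  have hσ' : ∀ a, v ((Equiv.swap i j * σ) a) = v (s a) := by
    intro a
    rw [Equiv.Perm.mul_apply, ← hσ]
    rcases eq_or_ne (σ a) i with h1 | h1
    · rw [h1, Equiv.swap_apply_left, hv]
    rcases eq_or_ne (σ a) j with h2 | h2
    · rw [h2, Equiv.swap_apply_right, hv]
    · rw [Equiv.swap_apply_of_ne_of_ne h1 h2]
  refine (hmin ⟨_, hσ'⟩).not_gt (Set.ncard_lt_ncard ⟨?_, ?_⟩ (Set.toFinite _))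
  · exact fun p hp => sameCycle_of_swap_mul hij hp
  · exact fun hsub => not_sameCycle_swap_mul hne hij (hsub (show (i, j) ∈ _ from hij))

/-- Version of `exists_perm_injOn_cycles` for a permutation preserving a function with finite
fibers. -/
theorem exists_perm_injOn_cycles_of_finite_fibers {α β V : Type*} (s : Equiv.Perm α) (v : α → V)
    (m : α → β) (hm : ∀ t, Finite {a // m a = t}) (hs : ∀ a, m (s a) = m a) :
    ∃ σ : Equiv.Perm α, (∀ a, m (σ a) = m a) ∧ (∀ a, v (σ a) = v (s a)) ∧
      ∀ a b, σ.SameCycle a b → v a = v b → a = b := by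
  -- Rewire inside each fiber separately, then glue; this keeps `m` invariant.
  have hex := fun t => exists_perm_injOn_cycles (α := {a // m a = t})
    (s.subtypePerm fun a => by rw [hs]) (fun a => v a)
  choose τ hτ hτinj using hex
  set σ : Equiv.Perm α := (Equiv.sigmaFiberEquiv m).permCongr (Equiv.Perm.sigmaCongrRight τ) with hσ
  have hval : ∀ a, σ a = τ (m a) ⟨a, rfl⟩ := fun a => rfl
  have hmσ : ∀ a, m (σ a) = m a := fun a => (τ (m a) ⟨a, rfl⟩).2
  have hval' : ∀ t (a : {a // m a = t}), σ a = τ t a := by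
    rintro t ⟨a, rfl⟩; rfl
  have hsymm : ∀ t (a : {a // m a = t}), σ.symm a = (τ t).symm a := by
    intro t a
    rw [Equiv.symm_apply_eq, hval', Equiv.apply_symm_apply]
  have hpow : ∀ t (n : ℤ) (a : {a // m a = t}), (σ ^ n) a = ((τ t) ^ n) a := by
    intro t n
    induction n using Int.induction_on with
    | zero => intro a; rfl
    | succ n ih => intro a; rw [zpow_add_one, zpow_add_one, Equiv.Perm.mul_apply,
        Equiv.Perm.mul_apply, hval', ih]
    | pred n ih => intro a; rw [zpow_sub_one, zpow_sub_one, Equiv.Perm.mul_apply,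
        Equiv.Perm.mul_apply, Equiv.Perm.inv_def, Equiv.Perm.inv_def, hsymm, ih]
  refine ⟨σ, hmσ, fun a => ?_, ?_⟩
  · rw [hval]
    exact hτ (m a) ⟨a, rfl⟩
  · rintro a b ⟨n, rfl⟩ hv
    have h := hpow (m a) n ⟨a, rfl⟩
    simp only at h
    rw [h] at hv ⊢
    exact congrArg Subtype.val (hτinj (m a) ⟨a, rfl⟩ _ ⟨n, rfl⟩ hv)

/-! ### Total entropy as the mean information of the atoms -/

/-- The information content `-log x ∈ [0,∞]` of an event of probability `x`. -/
noncomputable def information (x : ENNReal) : ENNReal := (-ENNReal.log x).toENNReal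

theorem information_antitone : Antitone information := fun _ _ h =>
  EReal.toENNReal_le_toENNReal (EReal.neg_le_neg_iff.2 (ENNReal.log_le_log h))

theorem continuous_information : Continuous information :=
  EReal.continuous_toENNReal.comp (continuous_neg.comp ENNReal.continuous_log)

theorem information_zero : information 0 = ⊤ := by
  simp [information]

theorem information_mul_self {x : ENNReal} (hx : x ≠ ⊤) :
    information x * x = ENNReal.ofReal (Real.negMulLog x.toReal) := by
  rcases eq_or_ne x 0 with rfl | h0
  · simp [Real.negMulLog]
  · have h1 : information x = ENNReal.ofReal (-Real.log x.toReal) := by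
      rw [information, ENNReal.log_pos_real h0 hx, ← EReal.coe_neg, EReal.toENNReal_of_ne_top
        (EReal.coe_ne_top _), EReal.toReal_coe]
    conv_lhs => rw [h1, ← ENNReal.ofReal_toReal hx]
    rw [ENNReal.toReal_ofReal ENNReal.toReal_nonneg, ← ENNReal.ofReal_mul' ENNReal.toReal_nonneg, Real.negMulLog]
    congr 1
    ring

theorem ofReal_entropy {Q : Type*} [Fintype Q] [MeasurableSpace Q] [MeasurableSingletonClass Q]
    (ν : Measure Q) [IsProbabilityMeasure ν] :
    ENNReal.ofReal (entropy ν) = ∫⁻ q, information (ν {q}) ∂ν := by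
  rw [lintegral_fintype, entropy, ← Finset.sum_neg_distrib, ENNReal.ofReal_sum_of_nonneg]
  · refine Finset.sum_congr rfl fun q _ => ?_
    rw [information_mul_self (measure_ne_top _ _), Real.negMulLog, neg_mul]
    rfl
  · intro q _
    have := Real.negMulLog_nonneg (x := ν.real {q}) measureReal_nonneg measureReal_le_one
    rwa [Real.negMulLog, neg_mul] at this

theorem measurable_shiftConfig (n : ℤ) : Measurable (shiftConfig n) :=
  measurable_pi_lambda _ fun _ => measurable_pi_apply _

theorem shiftConfig_shiftConfig (m n : ℤ) (η : Config) :
    shiftConfig m (shiftConfig n η) = shiftConfig (m + n) η := by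
  funext i
  simp [shiftConfig, add_assoc]

theorem shiftConfig_zero (η : Config) : shiftConfig 0 η = η := by
  funext i
  simp [shiftConfig]

/-- Translation as a permutation of the configurations. -/
def shiftEquiv (n : ℤ) : Config ≃ Config where
  toFun := shiftConfig n
  invFun := shiftConfig (-n)
  left_inv η := by rw [shiftConfig_shiftConfig, neg_add_cancel, shiftConfig_zero]
  right_inv η := by rw [shiftConfig_shiftConfig, add_neg_cancel, shiftConfig_zero]

theorem IsTI.measure_singleton {μ : Measure Config} (hμ : IsTI μ) (n : ℤ) (η : Config) :
    μ {shiftConfig n η} = μ {η} := by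
  conv_lhs => rw [← hμ n]
  rw [Measure.map_apply (measurable_shiftConfig n) (measurableSet_singleton _)]
  congr 1
  ext ω
  exact (shiftEquiv n).injective.eq_iff

/-- The restriction of a configuration to `{-j,…,j}`. -/
def centeredWindow (j : ℕ) (η : Config) : LocalConfig (2 * j) :=
  window (2 * j) (shiftConfig (-j) η)

theorem measurable_centeredWindow (j : ℕ) : Measurable (centeredWindow j) :=
  (measurable_window _).comp (measurable_shiftConfig _)

theorem centeredWindow_eq_iff (j : ℕ) (η ω : Config) :
    centeredWindow j ω = centeredWindow j η ↔ ∀ i : ℤ, |i| ≤ j → ω i = η i := by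
  constructor
  · intro h i hi
    rw [abs_le] at hi
    have := congrFun h ⟨(i + j).toNat, by omega⟩
    simp only [centeredWindow, window, shiftConfig] at this
    rw [Int.toNat_of_nonneg (by omega)] at this
    simpa using this
  · intro h
    funext i
    have := i.2
    exact h _ (abs_le.2 (by constructor <;> omega))

/-- Centred windows exhaust `ℤ`, so their cylinders shrink to single configurations; translation
invariance makes the recentring harmless. -/
theorem IsTI.ofReal_entropy_marginal {μ : Measure Config} [IsProbabilityMeasure μ] (hμ : IsTI μ)
    (j : ℕ) : ENNReal.ofReal (entropy (marginal (2 * j) μ)) =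
      ∫⁻ η, information (μ (centeredWindow j ⁻¹' {centeredWindow j η})) ∂μ := by
  have h : marginal (2 * j) μ = μ.map (centeredWindow j) := by
    conv_lhs => rw [marginal, ← hμ (-j), Measure.map_map (measurable_window _)
      (measurable_shiftConfig _)]
    rfl
  have : IsProbabilityMeasure (μ.map (centeredWindow j)) :=
    Measure.isProbabilityMeasure_map (measurable_centeredWindow j).aemeasurable
  rw [h, ofReal_entropy, lintegral_map (measurable_of_finite _) (measurable_centeredWindow j)]
  refine lintegral_congr fun η => ?_
  rw [Measure.map_apply (measurable_centeredWindow j) (measurableSet_singleton _)]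

theorem IsTI.totalEntropy_eq {μ : Measure Config} [IsProbabilityMeasure μ] (hμ : IsTI μ) :
    totalEntropy μ = ∫⁻ η, information (μ {η}) ∂μ := by
  have hsub : Tendsto (fun j : ℕ => 2 * j) atTop atTop :=
    tendsto_id.const_mul_atTop' (by norm_num)
  refine tendsto_nhds_unique ((tendsto_totalEntropy μ).comp hsub) ?_
  have hanti : ∀ η : Config, Antitone fun j => centeredWindow j ⁻¹' {centeredWindow j η} := by
    intro η i j hij ω hω
    simp only [Set.mem_preimage, Set.mem_singleton_iff, centeredWindow_eq_iff] at hω ⊢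
    exact fun l hl => hω l (hl.trans (by exact_mod_cast hij))
  have hInter : ∀ η : Config, ⋂ j, centeredWindow j ⁻¹' {centeredWindow j η} = {η} := by
    intro η
    ext ω
    simp only [Set.mem_iInter, Set.mem_preimage, Set.mem_singleton_iff, centeredWindow_eq_iff]
    refine ⟨fun h => funext fun i => h i.natAbs i (by simp), ?_⟩
    rintro rfl j i _
    rfl
  have hmeas : ∀ j (x : LocalConfig (2 * j)), MeasurableSet (centeredWindow j ⁻¹' {x}) :=
    fun j x => measurable_centeredWindow j (measurableSet_singleton _)
  refine (lintegral_tendsto_of_tendsto_of_monotone (μ := μ)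
    (f := fun j η => information (μ (centeredWindow j ⁻¹' {centeredWindow j η})))
    (F := fun η => information (μ {η})) ?_ ?_ ?_).congr fun j => (hμ.ofReal_entropy_marginal j).symm
  · intro j
    exact ((measurable_of_finite fun x : LocalConfig (2 * j) =>
      information (μ (centeredWindow j ⁻¹' {x}))).comp (measurable_centeredWindow j)).aemeasurable
  · exact ae_of_all _ fun η i j hij => information_antitone (measure_mono (hanti η hij))
  · refine ae_of_all _ fun η => (continuous_information.tendsto _).comp ?_
    have := tendsto_measure_iInter_atTop (μ := μ)
      (s := fun j => centeredWindow j ⁻¹' {centeredWindow j η})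
      (fun j => (hmeas j _).nullMeasurableSet) (hanti η) ⟨0, measure_ne_top _ _⟩
    rwa [hInter] at this

/-! ### Atomic measures -/

theorem measure_eq_sum_dirac {α : Type*} [MeasurableSpace α] [MeasurableSingletonClass α]
    (μ : Measure α) {A : Set α} (hA : A.Countable) (hμ : μ Aᶜ = 0) :
    μ = Measure.sum fun a : A => μ {a.1} • Measure.dirac a.1 := by
  have := hA.to_subtype
  ext s hs
  rw [Measure.sum_apply _ hs, ← setLIntegral_one, ← lintegral_indicator hs,
    ← lintegral_add_compl _ hA.measurableSet, lintegral_countable _ hA,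
    setLIntegral_measure_zero _ _ hμ, add_zero]
  refine tsum_congr fun a => ?_
  rw [Measure.smul_apply, Measure.dirac_apply' _ hs, smul_eq_mul, mul_comm]
  rfl

/-- Points of mass zero carry infinite information, so a non-atomic part of positive mass would make
the integral infinite. -/
theorem IsTI.atoms_of_totalEntropy_lt_top {μ : Measure Config} [IsProbabilityMeasure μ]
    (hμ : IsTI μ) (h : totalEntropy μ < ⊤) :
    {η | 0 < μ {η}}.Countable ∧ μ {η | 0 < μ {η}}ᶜ = 0 := by
  have hc : {η | 0 < μ {η}}.Countable :=
    Measure.countable_meas_pos_of_disjoint_iUnion (As := fun η : Config => {η})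
      (fun η => measurableSet_singleton η) fun η ω hne => by simpa using hne
  refine ⟨hc, ?_⟩
  by_contra hne
  refine h.ne ?_
  rw [hμ.totalEntropy_eq, eq_top_iff]
  calc ⊤ = ∫⁻ _ in {η | 0 < μ {η}}ᶜ, (⊤ : ENNReal) ∂μ := by
        rw [setLIntegral_const, ENNReal.top_mul hne]
    _ = ∫⁻ η in {η | 0 < μ {η}}ᶜ, information (μ {η}) ∂μ := by
        refine setLIntegral_congr_fun hc.measurableSet.compl fun η hη => ?_
        have h0 : μ {η} = 0 := by simpa using hη
        simp only [h0, information_zero]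
    _ ≤ _ := setLIntegral_le_lintegral _ _

/-! ### Weights on the periodic configurations of cycles -/

/-- The periodic configurations obtained by tracing the cycles of `G_k`. -/
def cycleConfigs (k : ℕ) : Set Config := {ω | ∃ C : ClosedPath k, C.IsCycle ∧ C.config = ω}

/-- A cycle visits each of the `2 ^ k` vertices at most once, which bounds its period. -/
theorem finite_cycleConfigs (k : ℕ) : (cycleConfigs k).Finite := by
  have hfin : (⋃ p ∈ Set.Icc 1 (2 ^ k), Set.range
      fun (u : ZMod p → Fin 2) (i : ℤ) => u (i : ZMod p)).Finite := by
    refine (Set.finite_Icc _ _).biUnion fun p hp => ?_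
    have : NeZero p := ⟨by have := hp.1; omega⟩
    exact Set.finite_range _
  refine hfin.subset ?_
  rintro _ ⟨C, hC, rfl⟩
  have : NeZero C.length := ⟨C.length_pos.ne'⟩
  simp only [Set.mem_iUnion]
  refine ⟨C.length, ⟨C.length_pos, ?_⟩, fun j => C.edge j 0, rfl⟩
  have := Fintype.card_le_of_injective _ hC
  simpa [ZMod.card] using this

noncomputable instance (k : ℕ) : Fintype (cycleConfigs k) := (finite_cycleConfigs k).fintype

/-- The closed path `P` started at its `n`-th edge. -/
def ClosedPath.rotate {k : ℕ} (P : ClosedPath k) (n : ℤ) : ClosedPath k where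
  length := P.length
  length_pos := P.length_pos
  edge j := P.edge (j + n)
  target_eq j := by rw [P.target_eq, add_right_comm]

theorem shiftConfig_mem_cycleConfigs {k : ℕ} {ω : Config} (hω : ω ∈ cycleConfigs k) (n : ℤ) :
    shiftConfig n ω ∈ cycleConfigs k := by
  obtain ⟨C, hC, rfl⟩ := hω
  refine ⟨C.rotate n, fun i j h => ?_, ?_⟩
  · exact add_right_cancel (G := ZMod C.length) (hC h)
  · funext i
    simp [ClosedPath.config, ClosedPath.rotate, shiftConfig]
    rfl

/-- Translation by `1` on a translation-invariant set of configurations. -/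
def shiftPerm (A : Set Config) (hA : ∀ η ∈ A, ∀ n, shiftConfig n η ∈ A) : Equiv.Perm A where
  toFun η := ⟨shiftConfig 1 η, hA _ η.2 1⟩
  invFun η := ⟨shiftConfig (-1) η, hA _ η.2 (-1)⟩
  left_inv η := Subtype.ext ((shiftEquiv 1).left_inv η)
  right_inv η := Subtype.ext ((shiftEquiv 1).right_inv η)

theorem shiftPerm_zpow_apply (A : Set Config) (hA : ∀ η ∈ A, ∀ n, shiftConfig n η ∈ A) (n : ℤ)
    (η : A) : ((shiftPerm A hA ^ n) η : Config) = shiftConfig n η := by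
  induction n using Int.induction_on generalizing η with
  | zero => exact (shiftConfig_zero _).symm
  | succ n ih =>
    rw [zpow_add_one, Equiv.Perm.mul_apply, ih]
    exact shiftConfig_shiftConfig _ _ _
  | pred n ih =>
    rw [zpow_sub_one, Equiv.Perm.mul_apply, ih]
    exact shiftConfig_shiftConfig _ _ _

/-- Translation by `1` on the configurations of cycles. -/
def cycleShift (k : ℕ) : Equiv.Perm (cycleConfigs k) :=
  shiftPerm (cycleConfigs k) fun _ hω n => shiftConfig_mem_cycleConfigs hω n

theorem cycleShift_zpow_apply {k : ℕ} (n : ℤ) (ω : cycleConfigs k) :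
    ((cycleShift k ^ n) ω : Config) = shiftConfig n ω :=
  shiftPerm_zpow_apply _ _ n ω

theorem target_window (k : ℕ) (η : Config) :
    target (window k η) = source (window k (shiftConfig 1 η)) := by
  funext i
  simp [target, source, window, shiftConfig]

/-- The edge weights on `G_k` induced by weights on the configurations of cycles. -/
noncomputable def edgeFlow (k : ℕ) : (cycleConfigs k → ℝ) →ₗ[ℝ] (LocalConfig k → ℝ) where
  toFun w e := ∑ ω : cycleConfigs k, if window k ω = e then w ω else 0
  map_add' w w' := by
    funext e
    simp [← Finset.sum_add_distrib, ← ite_add_zero]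
  map_smul' r w := by
    funext e
    simp [Finset.mul_sum]

theorem edgeFlow_apply {k : ℕ} (w : cycleConfigs k → ℝ) (e : LocalConfig k) :
    edgeFlow k w e = ∑ ω : cycleConfigs k, if window k ω = e then w ω else 0 := rfl

/-- A configuration whose window ends at `v` has a translate whose window starts at `v`; reindexing
by the shift matches inflow with outflow. -/
theorem isCirculation_edgeFlow {k : ℕ} {w : cycleConfigs k → ℝ}
    (hw : ∀ ω, w (cycleShift k ω) = w ω) : IsCirculation (edgeFlow k w) := by
  intro v
  simp only [edgeFlow_apply]
  rw [Finset.sum_comm, Finset.sum_comm (s := Finset.univ.filter fun e => target e = v)]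
  simp only [Finset.sum_ite_eq, Finset.mem_filter, Finset.mem_univ, true_and]
  rw [← Equiv.sum_comp (cycleShift k)]
  refine Finset.sum_congr rfl fun ω _ => ?_
  rw [hw, target_window]
  rfl

theorem apply_eq_of_sameCycle {α β : Type*} {s : Equiv.Perm α} {w : α → β}
    (hw : ∀ a, w (s a) = w a) {a b : α} (h : s.SameCycle a b) : w a = w b := by
  obtain ⟨n, rfl⟩ := h
  induction n using Int.induction_on with
  | zero => rfl
  | succ n ih => rw [add_comm, zpow_one_add, Equiv.Perm.mul_apply, hw, ← ih]
  | pred n ih =>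
    rw [sub_eq_neg_add, zpow_add, Equiv.Perm.mul_apply, ← hw ((s ^ (-1 : ℤ)) _), ih,
      ← Equiv.Perm.mul_apply s, ← zpow_one_add]
    simp

/-- The translation-invariant nonnegative weights with edge weights at most `f`. -/
def subWeights (k : ℕ) (f : LocalConfig k → ℝ) : Set (cycleConfigs k → ℝ) :=
  {w | (∀ ω, 0 ≤ w ω) ∧ (∀ ω, w (cycleShift k ω) = w ω) ∧ ∀ e, edgeFlow k w e ≤ f e}

/-- The translation-invariant nonnegative weights with edge weights `f`. -/
def exactWeights (k : ℕ) (f : LocalConfig k → ℝ) : Set (cycleConfigs k → ℝ) :=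
  {w | (∀ ω, 0 ≤ w ω) ∧ (∀ ω, w (cycleShift k ω) = w ω) ∧ edgeFlow k w = f}

theorem isCompact_subWeights (k : ℕ) (f : LocalConfig k → ℝ) : IsCompact (subWeights k f) := by
  refine (isCompact_Icc (a := (0 : cycleConfigs k → ℝ))
    (b := fun ω => f (window k ω))).of_isClosed_subset ?_ ?_
  · refine IsClosed.and ?_ (IsClosed.and ?_ ?_)
    · simp only [Set.ofPred_forall]
      exact isClosed_iInter fun ω => isClosed_le continuous_const (continuous_apply ω)
    · simp only [Set.ofPred_forall]
      exact isClosed_iInter fun ω => isClosed_eq (continuous_apply _) (continuous_apply ω)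
    · simp only [Set.ofPred_forall]
      exact isClosed_iInter fun e => isClosed_le
        ((continuous_apply e).comp (edgeFlow k).continuous_of_finiteDimensional) continuous_const
  -- Each weight is at most the flow through the edge that its configuration shows on `{0,…,k}`.
  · rintro w ⟨h0, -, hf⟩
    refine ⟨h0, fun ω => le_trans ?_ (hf _)⟩
    rw [edgeFlow_apply]
    refine le_trans (by simp) (Finset.single_le_sum (fun ω' _ => ?_) (Finset.mem_univ ω))
    split_ifs
    exacts [h0 _, le_rfl]

theorem isCompact_exactWeights (k : ℕ) (f : LocalConfig k → ℝ) : IsCompact (exactWeights k f) := by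
  have h : exactWeights k f = subWeights k f ∩ {w | edgeFlow k w = f} := by
    ext w
    constructor
    · exact fun h => ⟨⟨h.1, h.2.1, fun e => (congrFun h.2.2 e).le⟩, h.2.2⟩
    · exact fun h => ⟨h.1.1, h.1.2.1, h.2⟩
  rw [h]
  exact (isCompact_subWeights k f).inter_right
    (isClosed_eq (edgeFlow k).continuous_of_finiteDimensional continuous_const)

/-- Supplies the step size for perturbing `a` along `±b` without losing nonnegativity. -/
theorem exists_pos_mul_abs_le {ι : Type*} [Finite ι] (a b : ι → ℝ) (ha : ∀ i, 0 ≤ a i)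
    (h : ∀ i, b i ≠ 0 → 0 < a i) : ∃ ε > 0, ∀ i, ε * |b i| ≤ a i := by
  have hev : ∀ i, ∀ᶠ ε in 𝓝[>] (0 : ℝ), ε * |b i| ≤ a i := by
    intro i
    by_cases hb : b i = 0
    · simp [hb, ha]
    · have ht : Tendsto (fun ε : ℝ => ε * |b i|) (𝓝[>] 0) (𝓝 (0 * |b i|)) :=
        ((continuous_id.mul continuous_const).tendsto 0).mono_left nhdsWithin_le_nhds
      rw [zero_mul] at ht
      exact (ht.eventually_lt_const (h i hb)).mono fun _ => le_of_lt
  obtain ⟨ε, h1, h2⟩ := ((eventually_all.2 hev).and self_mem_nhdsWithin).exists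
  exact ⟨ε, h2, h1⟩

/-- Every nonnegative circulation is a combination of cycles. -/
theorem exactWeights_nonempty {k : ℕ} {f : LocalConfig k → ℝ} (hf : IsCirculation f)
    (hpos : ∀ e, 0 ≤ f e) : (exactWeights k f).Nonempty := by
  classical
  -- Take maximal total weight: a nonzero residual flow would contain a cycle, and a small multiple
  -- of its orbit could still be added.
  obtain ⟨w, ⟨hw0, hws, hwf⟩, hmax⟩ := (isCompact_subWeights k f).exists_isMaxOn
    (f := fun w => ∑ ω, w ω) ⟨0, by simp [subWeights, hpos]⟩ (by fun_prop)
  refine ⟨w, hw0, hws, ?_⟩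
  by_contra hne
  have hr : IsCirculation (f - edgeFlow k w) := hf.sub (isCirculation_edgeFlow hws)
  obtain ⟨e₀, he₀⟩ := Function.ne_iff.1 hne
  obtain ⟨C, hC, hCpos⟩ := hr.exists_cycle (fun e => sub_nonneg.2 (hwf e)) (e₀ := e₀)
    (sub_pos.2 (lt_of_le_of_ne (hwf e₀) he₀))
  set ω₀ : cycleConfigs k := ⟨C.config, C, hC, rfl⟩ with hω₀
  set u : cycleConfigs k → ℝ := fun ω => if (cycleShift k).SameCycle ω₀ ω then 1 else 0 with hu
  have hu0 : ∀ ω, 0 ≤ u ω := fun ω => by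
    simp only [hu]; split_ifs <;> norm_num
  have hus : ∀ ω, u (cycleShift k ω) = u ω := fun ω => by
    simp only [hu, Equiv.Perm.sameCycle_apply_right]
  obtain ⟨ε, hε, hle⟩ := exists_pos_mul_abs_le (f - edgeFlow k w) (edgeFlow k u)
    (fun e => sub_nonneg.2 (hwf e)) (by
      intro e he
      rw [edgeFlow_apply] at he
      obtain ⟨ω, -, hω⟩ := Finset.exists_ne_zero_of_sum_ne_zero he
      rw [ite_ne_right_iff] at hω
      obtain ⟨rfl, hω⟩ := hω
      simp only [hu, ne_eq, ite_eq_right_iff, one_ne_zero, imp_false, not_not] at hω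
      obtain ⟨n, rfl⟩ := hω
      rw [cycleShift_zpow_apply, C.window_shiftConfig_config]
      exact hCpos _)
  have hmem : w + ε • u ∈ subWeights k f := by
    refine ⟨fun ω => ?_, fun ω => ?_, fun e => ?_⟩
    · exact add_nonneg (hw0 ω) (mul_nonneg hε.le (hu0 ω))
    · simp [hws, hus]
    · have h1 := hle e
      have h2 := mul_le_mul_of_nonneg_left (le_abs_self (edgeFlow k u e)) hε.le
      simp only [Pi.sub_apply] at h1
      simp only [map_add, map_smul, Pi.add_apply, Pi.smul_apply, smul_eq_mul]
      linarith
  have h1 : ∑ ω, (w + ε • u) ω ≤ ∑ ω, w ω := hmax hmem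
  have h2 : 0 < ∑ ω, u ω := Finset.sum_pos' (fun ω _ => hu0 ω)
    ⟨ω₀, Finset.mem_univ _, by simp [hu, Equiv.Perm.SameCycle.refl]⟩
  simp only [Pi.add_apply, Pi.smul_apply, smul_eq_mul, Finset.sum_add_distrib,
    ← Finset.mul_sum] at h1
  nlinarith [mul_pos hε h2]

/-! ### Minimising the entropy -/

/-- The entropy of the atomic measure with the given weights. -/
noncomputable def weightEntropy {k : ℕ} (w : cycleConfigs k → ℝ) : ℝ := ∑ ω, Real.negMulLog (w ω)

/-- By strict concavity of `-x log x`, a minimiser is never the midpoint of a nondegenerate segment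
with endpoints in `K`. -/
theorem eq_zero_of_isMinOn_weightEntropy {k : ℕ} {K : Set (cycleConfigs k → ℝ)}
    (hK : ∀ w ∈ K, ∀ ω, 0 ≤ w ω) {w D : cycleConfigs k → ℝ} (hmin : IsMinOn weightEntropy K w)
    (h1 : w + D ∈ K) (h2 : w - D ∈ K) : D = 0 := by
  by_contra hD
  obtain ⟨ω₀, hω₀⟩ := Function.ne_iff.1 hD
  have hmid : ∀ ω, w ω = (1 / 2 : ℝ) • (w + D) ω + (1 / 2 : ℝ) • (w - D) ω := by
    intro ω
    simp only [Pi.add_apply, Pi.sub_apply, smul_eq_mul]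
    ring
  have hle : ∀ ω, (1 / 2 : ℝ) * Real.negMulLog ((w + D) ω) + 1 / 2 * Real.negMulLog ((w - D) ω) ≤
      Real.negMulLog (w ω) := by
    intro ω
    conv_rhs => rw [hmid]
    exact Real.concaveOn_negMulLog.2 (hK _ h1 ω) (hK _ h2 ω) (by norm_num) (by norm_num)
      (by norm_num)
  have hlt : (1 / 2 : ℝ) * Real.negMulLog ((w + D) ω₀) + 1 / 2 * Real.negMulLog ((w - D) ω₀) <
      Real.negMulLog (w ω₀) := by
    conv_rhs => rw [hmid]
    refine Real.strictConcaveOn_negMulLog.2 (hK _ h1 ω₀) (hK _ h2 ω₀) ?_ (by norm_num)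
      (by norm_num) (by norm_num)
    intro h
    refine hω₀ ?_
    simp only [Pi.add_apply, Pi.sub_apply, Pi.zero_apply] at h ⊢
    linarith
  have hsum := Finset.sum_lt_sum (fun ω _ => hle ω) ⟨ω₀, Finset.mem_univ _, hlt⟩
  rw [Finset.sum_add_distrib, ← Finset.mul_sum, ← Finset.mul_sum] at hsum
  have e1 : weightEntropy w ≤ weightEntropy (w + D) := hmin h1
  have e2 : weightEntropy w ≤ weightEntropy (w - D) := hmin h2
  unfold weightEntropy at e1 e2
  linarith

/-- The translation orbits of configurations of cycles. -/
abbrev CycleOrbit (k : ℕ) : Type := Quotient (Equiv.Perm.SameCycle.setoid (cycleShift k))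

/-- The orbit of a configuration. -/
def toOrbit {k : ℕ} (ω : cycleConfigs k) : CycleOrbit k := Quotient.mk _ ω

theorem toOrbit_eq_iff {k : ℕ} {ω ω' : cycleConfigs k} :
    toOrbit ω = toOrbit ω' ↔ (cycleShift k).SameCycle ω ω' := Quotient.eq

/-- The orbits on which `w` is positive. -/
def orbitSupport {k : ℕ} (w : cycleConfigs k → ℝ) : Set (CycleOrbit k) :=
  {q | ∃ ω, toOrbit ω = q ∧ 0 < w ω}

theorem toOrbit_mem_orbitSupport_iff {k : ℕ} {w : cycleConfigs k → ℝ}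
    (hw : ∀ ω, w (cycleShift k ω) = w ω) {ω : cycleConfigs k} :
    toOrbit ω ∈ orbitSupport w ↔ 0 < w ω := by
  refine ⟨?_, fun h => ⟨ω, rfl, h⟩⟩
  rintro ⟨ω', h, hpos⟩
  rwa [← apply_eq_of_sameCycle hw (toOrbit_eq_iff.1 h)]

open Classical in
/-- Extension by zero of a function on a set of orbits to an invariant function on
configurations. -/
noncomputable def orbitExtend {k : ℕ} (S : Set (CycleOrbit k)) :
    (S → ℝ) →ₗ[ℝ] (cycleConfigs k → ℝ) where
  toFun d ω := if h : toOrbit ω ∈ S then d ⟨toOrbit ω, h⟩ else 0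
  map_add' d d' := by
    funext ω
    by_cases h : toOrbit ω ∈ S <;> simp [h]
  map_smul' r d := by
    funext ω
    by_cases h : toOrbit ω ∈ S <;> simp [h]

theorem exists_invariant_edgeFlow_eq_zero {k : ℕ} (S : Set (CycleOrbit k))
    (hS : 2 ^ k + 1 < S.ncard) :
    ∃ D : cycleConfigs k → ℝ, D ≠ 0 ∧ (∀ ω, D (cycleShift k ω) = D ω) ∧
      (∀ ω, D ω ≠ 0 → toOrbit ω ∈ S) ∧ edgeFlow k D = 0 := by
  classical
  have : Fintype S := Fintype.ofFinite S
  -- The `2 ^ k + 1` edges whose values determine a circulation. With more orbits than test edges,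
  -- the linear map `L` has a kernel.
  let p : Option (Fin k → Fin 2) → LocalConfig k
    | none => 0
    | some θ => Fin.cons (1 : Fin 2) θ
  let L : (S → ℝ) →ₗ[ℝ] (Option (Fin k → Fin 2) → ℝ) :=
    (LinearMap.funLeft ℝ ℝ p).comp ((edgeFlow k).comp (orbitExtend S))
  have hker : LinearMap.ker L ≠ ⊥ := by
    refine LinearMap.ker_ne_bot_of_finrank_lt ?_
    rw [Module.finrank_fintype_fun_eq_card, Module.finrank_fintype_fun_eq_card]
    rw [← Nat.card_coe_set_eq, Nat.card_eq_fintype_card] at hS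
    simpa using hS
  obtain ⟨d, hd, hd0⟩ := Submodule.exists_mem_ne_zero_of_ne_bot hker
  have hLd : ∀ i, edgeFlow k (orbitExtend S d) (p i) = 0 := fun i => congrFun hd i
  have hinv : ∀ ω, orbitExtend S d (cycleShift k ω) = orbitExtend S d ω := by
    intro ω
    have h : toOrbit (cycleShift k ω) = toOrbit ω := by
      rw [toOrbit_eq_iff, Equiv.Perm.sameCycle_apply_left]
    simp only [orbitExtend, LinearMap.coe_mk, AddHom.coe_mk, h]
  refine ⟨orbitExtend S d, ?_, hinv, ?_, ?_⟩
  · intro h0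
    refine hd0 (funext fun q => ?_)
    obtain ⟨q, hq⟩ := q
    obtain ⟨ω, rfl⟩ := Quotient.exists_rep q
    have h := congrFun h0 ω
    have hq' : toOrbit ω ∈ S := hq
    simp only [orbitExtend, LinearMap.coe_mk, AddHom.coe_mk, hq', dif_pos] at h
    exact h
  · intro ω h
    by_contra hω
    exact h (by simp [orbitExtend, hω])
  · refine (isCirculation_edgeFlow hinv).eq_zero (fun e he => ?_) (hLd none)
    have h := hLd (some (Fin.tail e))
    have hp : p (some (Fin.tail e)) = e := by
      simp only [p]
      rw [← he, Fin.cons_self_tail]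
    rwa [hp] at h

theorem exists_minimal_weights {k : ℕ} {f : LocalConfig k → ℝ} (hf : IsCirculation f)
    (hpos : ∀ e, 0 ≤ f e) :
    ∃ w ∈ exactWeights k f, IsMinOn weightEntropy (exactWeights k f) w ∧
      (orbitSupport w).ncard ≤ 2 ^ k + 1 := by
  obtain ⟨w, hw, hmin⟩ := (isCompact_exactWeights k f).exists_isMinOn
    (exactWeights_nonempty hf hpos) (f := weightEntropy)
    (continuous_finsetSum _ fun ω _ =>
      Real.continuous_negMulLog.comp (continuous_apply ω)).continuousOn
  refine ⟨w, hw, hmin, ?_⟩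
  by_contra! hcard
  obtain ⟨D, hD0, hDs, hDsupp, hDf⟩ := exists_invariant_edgeFlow_eq_zero _ hcard
  obtain ⟨hw0, hws, hwf⟩ := hw
  -- As `D` lives where `w` is positive and has zero edge flow, both `w + ε • D` and `w - ε • D`
  -- remain admissible.
  obtain ⟨ε, hε, hle⟩ := exists_pos_mul_abs_le w D hw0 fun ω h =>
    (toOrbit_mem_orbitSupport_iff hws).1 (hDsupp ω h)
  have hle' : ∀ ω, |ε * D ω| ≤ w ω := fun ω => by rw [abs_mul, abs_of_pos hε]; exact hle ω
  have h := eq_zero_of_isMinOn_weightEntropy (K := exactWeights k f) (fun w hw => hw.1)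
    (D := ε • D) hmin ⟨fun ω => ?_, fun ω => ?_, ?_⟩ ⟨fun ω => ?_, fun ω => ?_, ?_⟩
  · exact hD0 ((smul_eq_zero.1 h).resolve_left hε.ne')
  · have := (abs_le.1 (hle' ω)).1
    simp only [Pi.add_apply, Pi.smul_apply, smul_eq_mul]
    linarith
  · simp [hws, hDs]
  · simp [hwf, hDf]
  · have := (abs_le.1 (hle' ω)).2
    simp only [Pi.sub_apply, Pi.smul_apply, smul_eq_mul]
    linarith
  · simp [hws, hDs]
  · simp [hwf, hDf]

/-! ### Weighted sums of point masses -/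

/-- The measure with mass `m a` at each point `T a`. -/
noncomputable def atomicMeasure {α β : Type*} [MeasurableSpace β] (T : α → β) (m : α → ENNReal) :
    Measure β :=
  Measure.sum fun a => m a • Measure.dirac (T a)

theorem map_atomicMeasure {α β γ : Type*} [MeasurableSpace β] [MeasurableSpace γ] (T : α → β)
    (m : α → ENNReal) {φ : β → γ} (hφ : Measurable φ) :
    (atomicMeasure T m).map φ = atomicMeasure (fun a => φ (T a)) m := by
  unfold atomicMeasure
  rw [Measure.map_sum hφ.aemeasurable]
  congr 1
  funext a
  rw [Measure.map_smul, Measure.map_dirac' hφ]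

theorem atomicMeasure_apply {α β : Type*} [MeasurableSpace β] (T : α → β) (m : α → ENNReal)
    {s : Set β} (hs : MeasurableSet s) :
    atomicMeasure T m s = ∑' a, m a * s.indicator 1 (T a) := by
  rw [atomicMeasure, Measure.sum_apply _ hs]
  refine tsum_congr fun a => ?_
  rw [Measure.smul_apply, Measure.dirac_apply' _ hs, smul_eq_mul]

theorem atomicMeasure_comp_equiv {α β : Type*} [MeasurableSpace β] (T : α → β) (m : α → ENNReal)
    (σ : α ≃ α) : atomicMeasure (fun a => T (σ a)) (fun a => m (σ a)) = atomicMeasure T m := by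
  ext s hs
  rw [atomicMeasure_apply _ _ hs, atomicMeasure_apply _ _ hs]
  exact σ.tsum_eq fun a => m a * s.indicator 1 (T a)

theorem lintegral_atomicMeasure {α β : Type*} [MeasurableSpace β] [MeasurableSingletonClass β]
    (T : α → β) (m : α → ENNReal) (g : β → ENNReal) :
    ∫⁻ b, g b ∂(atomicMeasure T m) = ∑' a, m a * g (T a) := by
  rw [atomicMeasure, lintegral_sum_measure]
  refine tsum_congr fun a => ?_
  rw [lintegral_smul_measure, lintegral_dirac, smul_eq_mul]

/-- `T` need not be injective: merged points add their masses. This inequality is the source of the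
entropy decrease. -/
theorem le_atomicMeasure_singleton {α β : Type*} [MeasurableSpace β] [MeasurableSingletonClass β]
    (T : α → β) (m : α → ENNReal) (a : α) : m a ≤ atomicMeasure T m {T a} := by
  rw [atomicMeasure_apply _ _ (measurableSet_singleton _)]
  refine le_trans ?_ (ENNReal.le_tsum a)
  simp

theorem isTI_iff_shift_one {μ : Measure Config} : IsTI μ ↔ μ.map (shiftConfig 1) = μ := by
  refine ⟨fun h => h 1, fun h => ?_⟩
  have hcomp : ∀ m n : ℤ, (μ.map (shiftConfig m)).map (shiftConfig n) =
      μ.map (shiftConfig (n + m)) := by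
    intro m n
    rw [Measure.map_map (measurable_shiftConfig _) (measurable_shiftConfig _)]
    congr 1
    funext η
    exact shiftConfig_shiftConfig _ _ _
  have h0 : μ.map (shiftConfig 0) = μ := by
    rw [show shiftConfig 0 = id from funext shiftConfig_zero, Measure.map_id]
  have hneg : μ.map (shiftConfig (-1)) = μ := by
    conv_lhs => rw [← h]
    rw [hcomp, neg_add_cancel, h0]
  intro n
  induction n using Int.induction_on with
  | zero => exact h0
  | succ n ih => rw [← hcomp, h, ih]
  | pred n ih => rw [sub_eq_add_neg, ← hcomp, hneg, ih]

theorem isTI_atomicMeasure {α : Type*} {T : α → Config} {m : α → ENNReal} (σ : Equiv.Perm α)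
    (hT : ∀ a, shiftConfig 1 (T a) = T (σ a)) (hm : ∀ a, m (σ a) = m a) :
    IsTI (atomicMeasure T m) := by
  rw [isTI_iff_shift_one, map_atomicMeasure _ _ (measurable_shiftConfig 1)]
  conv_rhs => rw [← atomicMeasure_comp_equiv T m σ]
  simp only [hT, hm]

theorem isProbabilityMeasure_of_marginal {k : ℕ} {μ : Measure Config} {μk : Measure (LocalConfig k)}
    [IsProbabilityMeasure μk] (h : marginal k μ = μk) : IsProbabilityMeasure μ :=
  ⟨by rw [← measure_univ (μ := μk), ← h, marginal, Measure.map_apply (measurable_window k)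
    MeasurableSet.univ, Set.preimage_univ]⟩

/-! ### Measures on the configurations of cycles -/

/-- The measure on configurations with the given weights. -/
noncomputable def weightMeasure {k : ℕ} (w : cycleConfigs k → ℝ) : Measure Config :=
  atomicMeasure (fun ω : cycleConfigs k => (ω : Config)) fun ω => ENNReal.ofReal (w ω)

theorem weightMeasure_singleton {k : ℕ} (w : cycleConfigs k → ℝ) (ω : cycleConfigs k) :
    weightMeasure w {(ω : Config)} = ENNReal.ofReal (w ω) := by
  rw [weightMeasure, atomicMeasure_apply _ _ (measurableSet_singleton _), tsum_eq_single ω]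
  · simp
  · intro ω' h
    simp [Subtype.coe_injective.ne h]

theorem marginal_weightMeasure_singleton {k : ℕ} {w : cycleConfigs k → ℝ} (hw : ∀ ω, 0 ≤ w ω)
    (e : LocalConfig k) :
    marginal k (weightMeasure w) {e} = ENNReal.ofReal (edgeFlow k w e) := by
  rw [marginal, weightMeasure, map_atomicMeasure _ _ (measurable_window k),
    atomicMeasure_apply _ _ (measurableSet_singleton _), tsum_fintype, edgeFlow_apply,
    ENNReal.ofReal_sum_of_nonneg]
  · refine Finset.sum_congr rfl fun ω _ => ?_
    by_cases h : window k ω = e <;> simp [h]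
  · intro ω _
    split_ifs
    exacts [hw ω, le_rfl]

theorem isTI_weightMeasure {k : ℕ} {w : cycleConfigs k → ℝ}
    (hw : ∀ ω, w (cycleShift k ω) = w ω) : IsTI (weightMeasure w) :=
  isTI_atomicMeasure (cycleShift k) (fun _ => rfl) fun ω => by rw [hw]

theorem isTIExtension_weightMeasure {k : ℕ} {μk : Measure (LocalConfig k)}
    [IsProbabilityMeasure μk] {w : cycleConfigs k → ℝ}
    (hw : w ∈ exactWeights k fun e => μk.real {e}) : IsTIExtension (weightMeasure w) μk := by
  have h : marginal k (weightMeasure w) = μk := by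
    refine Measure.ext_of_singleton fun e => ?_
    rw [marginal_weightMeasure_singleton hw.1, hw.2.2, ofReal_measureReal]
  exact ⟨isProbabilityMeasure_of_marginal h, isTI_weightMeasure hw.2.1, h⟩

theorem totalEntropy_weightMeasure {k : ℕ} {w : cycleConfigs k → ℝ}
    [IsProbabilityMeasure (weightMeasure w)] (hw : ∀ ω, 0 ≤ w ω)
    (hws : ∀ ω, w (cycleShift k ω) = w ω) :
    totalEntropy (weightMeasure w) = ENNReal.ofReal (weightEntropy w) := by
  rw [(isTI_weightMeasure hws).totalEntropy_eq, weightEntropy, ENNReal.ofReal_sum_of_nonneg]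
  · conv_lhs => rw [weightMeasure, lintegral_atomicMeasure, tsum_fintype]
    refine Finset.sum_congr rfl fun ω _ => ?_
    change _ * information (weightMeasure w _) = _
    rw [weightMeasure_singleton, mul_comm, information_mul_self ENNReal.ofReal_ne_top,
      ENNReal.toReal_ofReal (hw ω)]
  · intro ω _
    refine Real.negMulLog_nonneg (hw ω) ?_
    rw [← ENNReal.ofReal_le_one, ← weightMeasure_singleton]
    exact prob_le_one

/-! ### Cutting a measure of finite entropy into cycles -/

theorem config_mem_cycleConfigs {k : ℕ} {α : Type*} (σ : Equiv.Perm α) (E : α → LocalConfig k)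
    (hE : ∀ a, target (E a) = source (E (σ a)))
    (hinj : ∀ a b, σ.SameCycle a b → source (E a) = source (E b) → a = b) (a : α)
    (ha : a ∈ Function.periodicPts σ) : (fun n : ℤ => E ((σ ^ n) a) 0) ∈ cycleConfigs k := by
  have hp := Function.minimalPeriod_pos_of_mem_periodicPts ha
  refine ⟨orbitPath σ a hp E hE, orbitPath_isCycle _ _ _ _ _ fun m n h => hinj _ _ ?_ h, ?_⟩
  · rw [Equiv.Perm.iterate_eq_pow, Equiv.Perm.iterate_eq_pow, Equiv.Perm.sameCycle_pow_left,
      Equiv.Perm.sameCycle_pow_right]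
  · funext n
    change E (σ^[ZMod.val (n : ZMod (Function.minimalPeriod σ a))] a) 0 = _
    have : NeZero (Function.minimalPeriod σ a) := ⟨hp.ne'⟩
    have hfix : (σ ^ (Function.minimalPeriod σ a)) a = a := by
      rw [← Equiv.Perm.iterate_eq_pow]
      exact Function.isPeriodicPt_minimalPeriod σ a
    rw [Equiv.Perm.iterate_eq_pow, ← zpow_natCast, ZMod.val_intCast]
    conv_rhs => rw [← Int.emod_add_mul_ediv n (Function.minimalPeriod σ a), zpow_add, zpow_mul,
      zpow_natCast, Equiv.Perm.mul_apply, Equiv.Perm.zpow_apply_eq_self_of_apply_eq_self hfix]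

theorem exists_weights_of_totalEntropy_lt_top {k : ℕ} {μk : Measure (LocalConfig k)}
    [IsProbabilityMeasure μk] {μ : Measure Config} (hμ : IsTIExtension μ μk)
    (hS : totalEntropy μ < ⊤) :
    ∃ w ∈ exactWeights k fun e => μk.real {e},
      ENNReal.ofReal (weightEntropy w) ≤ totalEntropy μ := by
  have := hμ.isProbabilityMeasure
  have hTI := hμ.isTI
  obtain ⟨hc, hnull⟩ := hTI.atoms_of_totalEntropy_lt_top hS
  set A : Set Config := {η | 0 < μ {η}} with hA
  have hAshift : ∀ η ∈ A, ∀ n, shiftConfig n η ∈ A := fun η hη n => by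
    simp only [hA, Set.mem_ofPred_eq, hTI.measure_singleton]
    exact hη
  set m : A → ENNReal := fun a => μ {a.1} with hm
  have hfin : ∀ t, Finite {a : A // m a = t} := by
    intro t
    rcases isEmpty_or_nonempty {a : A // m a = t} with h | ⟨⟨⟨a, ha⟩, rfl⟩⟩
    · infer_instance
    -- A finite measure has only finitely many atoms of mass at least a given positive number.
    have hf : {η : Config | μ {a} ≤ μ {η}}.Finite := by
      by_contra hinf
      refine measure_ne_top μ _ (Set.Infinite.meas_eq_top (μ := μ) hinf ⟨μ {a}, ?_, fun _ h => h⟩)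
      exact (show 0 < μ {a} from ha).ne'
    have := hf.to_subtype
    refine Finite.of_injective (fun b : {b : A // m b = m ⟨a, ha⟩} =>
      (⟨b.1.1, b.2.ge⟩ : {η : Config | μ {a} ≤ μ {η}})) fun b b' h => ?_
    exact Subtype.ext (Subtype.ext (congrArg (fun x => x.1) h))
  obtain ⟨σ, hmσ, hvσ, hinj⟩ := exists_perm_injOn_cycles_of_finite_fibers (shiftPerm A hAshift)
    (fun a => source (window k a.1)) m hfin fun a => hTI.measure_singleton 1 a.1
  have hE : ∀ a : A, target (window k a.1) = source (window k (σ a).1) := fun a => by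
    rw [hvσ, target_window]
    rfl
  -- The configuration read off along the rewired orbit of `a`.
  set T : A → Config := fun a n => window k ((σ ^ n) a).1 0 with hT
  have hper : ∀ a, a ∈ Function.periodicPts σ := by
    intro a
    have hfib : ∀ n : ℕ, m (σ^[n] a) = m a := fun n => by
      induction n with
      | zero => rfl
      | succ n ih => rw [Function.iterate_succ_apply', hmσ, ih]
    have := hfin (m a)
    obtain ⟨i, j, hij, h⟩ := Finite.exists_ne_map_eq_of_infinite
      fun n : ℕ => (⟨σ^[n] a, hfib n⟩ : {b : A // m b = m a})
    wlog hlt : i < j generalizing i j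
    · exact this j i hij.symm h.symm (by omega)
    refine ⟨j - i, by omega, (σ.injective.iterate i) ?_⟩
    rw [← Function.iterate_add_apply, Nat.add_sub_cancel' hlt.le]
    exact (congrArg Subtype.val h).symm
  have hTmem : ∀ a, T a ∈ cycleConfigs k := fun a =>
    config_mem_cycleConfigs σ (fun a : A => window k a.1) hE hinj a (hper a)
  -- Rewiring still follows paths in `G_k`, so the window at the origin, and with it the marginal on
  -- `X_k`, is unchanged.
  have hTwin : ∀ a, window k (T a) = window k a.1 := by
    intro a
    have h := window_shiftConfig_of_path (E := fun n : ℤ => window k ((σ ^ n) a).1)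
      (fun n => by rw [hE, add_comm, zpow_one_add, Equiv.Perm.mul_apply]) 0
    rwa [shiftConfig_zero] at h
  have hTshift : ∀ a, shiftConfig 1 (T a) = T (σ a) := by
    intro a
    funext n
    simp only [hT, shiftConfig, zpow_add_one, Equiv.Perm.mul_apply]
  have hμeq : μ = atomicMeasure (fun a : A => a.1) m := measure_eq_sum_dirac μ hc hnull
  set μ' := atomicMeasure T m with hμ'
  have hTI' : IsTI μ' := isTI_atomicMeasure σ hTshift hmσ
  have hmarg' : marginal k μ' = μk := by
    rw [← hμ.marginal_eq, marginal, marginal, hμ', map_atomicMeasure _ _ (measurable_window k)]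
    conv_rhs => rw [hμeq, map_atomicMeasure _ _ (measurable_window k)]
    simp only [hTwin]
  have hprob' : IsProbabilityMeasure μ' := isProbabilityMeasure_of_marginal hmarg'
  set w : cycleConfigs k → ℝ := fun ω => μ'.real {ω.1} with hw
  have hwμ' : μ' = weightMeasure w := by
    have hms := (finite_cycleConfigs k).measurableSet
    refine (measure_eq_sum_dirac μ' (finite_cycleConfigs k).countable ?_).trans ?_
    · rw [hμ', atomicMeasure_apply _ _ hms.compl]
      simp [hTmem]
    · simp only [weightMeasure, atomicMeasure, hw, measureReal_def,
        ENNReal.ofReal_toReal (measure_ne_top μ' _)]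
  have hw0 : ∀ ω, 0 ≤ w ω := fun ω => measureReal_nonneg
  have hws : ∀ ω, w (cycleShift k ω) = w ω := fun ω =>
    congrArg ENNReal.toReal (hTI'.measure_singleton 1 ω.1)
  have hwf : edgeFlow k w = fun e => μk.real {e} := by
    funext e
    have h0 : 0 ≤ edgeFlow k w e := by
      rw [edgeFlow_apply]
      refine Finset.sum_nonneg fun ω _ => ?_
      split_ifs
      exacts [hw0 ω, le_rfl]
    rw [measureReal_def, ← hmarg', hwμ', marginal_weightMeasure_singleton hw0,
      ENNReal.toReal_ofReal h0]
  refine ⟨w, ⟨hw0, hws, hwf⟩, ?_⟩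
  have hprobw : IsProbabilityMeasure (weightMeasure w) := hwμ' ▸ hprob'
  rw [← totalEntropy_weightMeasure hw0 hws, ← hwμ', hTI'.totalEntropy_eq, hTI.totalEntropy_eq]
  conv_lhs => rw [hμ', lintegral_atomicMeasure]
  conv_rhs => rw [hμeq, lintegral_atomicMeasure, ← hμeq]
  -- Both entropies are sums over the old atoms with the same masses `m a`; only the information
  -- factors differ.
  refine ENNReal.tsum_le_tsum fun a => ?_
  gcongr
  exact information_antitone (le_atomicMeasure_singleton T m a)

/-! ### Local translation invariance and circulations -/

theorem IsLTI.isCirculation {k : ℕ} {μk : Measure (LocalConfig k)} [IsProbabilityMeasure μk]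
    (h : IsLTI μk) : IsCirculation fun e => μk.real {e} := by
  intro v
  -- Translating `{0,…,k-1}` by `1` compares the laws of the initial and final vertices of a random
  -- edge.
  set A : Set (Fin (k + 1)) := {i | (i : ℕ) < k} with hA
  have hAlt : ∀ i : A, (i.1 : ℕ) < k := fun i => i.2
  have h1 := h 1 A (fun i => ⟨(i.1 : ℕ) + 1, by have := hAlt i; omega⟩) fun i => by simp
  have h2 := congrArg (fun ν => ν.real {x | ∀ i : Fin k, x ⟨i.castSucc, i.2⟩ = v i}) h1
  beta_reduce at h2
  rw [map_measureReal_apply (measurable_of_finite _) (Set.toFinite _).measurableSet,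
    map_measureReal_apply (measurable_of_finite _) (Set.toFinite _).measurableSet] at h2
  rw [sum_measureReal_singleton, sum_measureReal_singleton]
  convert h2.symm using 2
  · ext e
    simp [source, funext_iff]
  · ext e
    simp [target, funext_iff, Fin.succ]

/-! ### Decomposition into cycles -/

theorem sum_orbit_eq {k : ℕ} {M : Type*} [AddCommMonoid M] (C : ClosedPath k) (hC : C.IsCycle)
    (ω₀ : cycleConfigs k) (hω₀ : C.config = ω₀) [DecidableEq (CycleOrbit k)] (h : Config → M) :
    ∑ ω : cycleConfigs k with toOrbit ω = toOrbit ω₀, h ω =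
      ∑ n ∈ Finset.range C.length, h (shiftConfig n C.config) := by
  symm
  refine Finset.sum_bij (fun n _ => (cycleShift k ^ (n : ℤ)) ω₀) ?_ ?_ ?_ ?_
  · intro n _
    simp only [Finset.mem_filter, Finset.mem_univ, true_and, toOrbit_eq_iff]
    rw [Equiv.Perm.sameCycle_zpow_left]
  -- Distinct translates are separated by the initial vertices of their edges, which a cycle never
  -- repeats.
  · intro m hm n hn hmn
    have h1 := congrArg (fun ω : cycleConfigs k => window k ω.1) hmn
    simp only [cycleShift_zpow_apply, ← hω₀, C.window_shiftConfig_config] at h1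
    have h2 := hC (congrArg source h1)
    simp only [Int.cast_natCast] at h2
    rw [ZMod.natCast_eq_natCast_iff', Nat.mod_eq_of_lt (Finset.mem_range.1 hm),
      Nat.mod_eq_of_lt (Finset.mem_range.1 hn)] at h2
    exact h2
  · intro ω hω
    simp only [Finset.mem_filter, Finset.mem_univ, true_and, toOrbit_eq_iff] at hω
    obtain ⟨n, rfl⟩ := hω.symm
    have hpos : (0 : ℤ) < C.length := by exact_mod_cast C.length_pos
    have hn0 := Int.emod_nonneg n hpos.ne'
    have hn1 := Int.emod_lt_of_pos n hpos
    refine ⟨(n % C.length).toNat, Finset.mem_range.2 (by omega), Subtype.ext ?_⟩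
    rw [cycleShift_zpow_apply, cycleShift_zpow_apply, Int.toNat_of_nonneg hn0, ← hω₀]
    funext i
    simp [shiftConfig, ClosedPath.config]
  · intro n _
    rw [cycleShift_zpow_apply, hω₀]

theorem ClosedPath.measure_univ {k : ℕ} (P : ClosedPath k) : P.measure Set.univ = 1 := by
  have h : (P.length : ENNReal) ≠ 0 := by exact_mod_cast P.length_pos.ne'
  simp [ClosedPath.measure, ENNReal.inv_mul_cancel h (ENNReal.natCast_ne_top _)]

/-- The loop at the zero vertex. -/
def zeroLoop (k : ℕ) : ClosedPath k where
  length := 1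
  length_pos := one_pos
  edge _ := 0
  target_eq _ := rfl

theorem zeroLoop_isCycle (k : ℕ) : (zeroLoop k).IsCycle := fun i j _ =>
  Subsingleton.elim (α := ZMod 1) i j

theorem weightMeasure_eq_sum_cycles {k : ℕ} {w : cycleConfigs k → ℝ} (hw : ∀ ω, 0 ≤ w ω)
    (hws : ∀ ω, w (cycleShift k ω) = w ω) {N : ℕ} (hN : (orbitSupport w).ncard ≤ N) :
    ∃ (C : Fin N → ClosedPath k) (c : Fin N → ℝ), (∀ i, (C i).IsCycle) ∧ (∀ i, 0 ≤ c i) ∧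
      weightMeasure w = ∑ i, ENNReal.ofReal (c i) • (C i).measure := by
  classical
  choose P hP hPc using fun ω : cycleConfigs k => ω.2
  have : Fintype (orbitSupport w) := Fintype.ofFinite _
  obtain ⟨e⟩ : Nonempty (orbitSupport w ↪ Fin N) := by
    refine Function.Embedding.nonempty_of_card_le ?_
    rw [← Nat.card_coe_set_eq, Nat.card_eq_fintype_card] at hN
    simpa using hN
  set C₀ : CycleOrbit k → ClosedPath k := fun q => P q.out with hC₀
  -- The total mass of the orbit: `w` is constant on it, and the orbit has as many points as the
  -- cycle has edges.
  set c₀ : CycleOrbit k → ℝ := fun q => (C₀ q).length * w q.out with hc₀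
  have hc₀n : ∀ q, 0 ≤ c₀ q := fun q => mul_nonneg (Nat.cast_nonneg _) (hw _)
  have hq : ∀ q : CycleOrbit k, toOrbit q.out = q := fun q => Quotient.out_eq q
  have horbit : ∀ q : CycleOrbit k,
      ∑ ω : cycleConfigs k with toOrbit ω = q, ENNReal.ofReal (w ω) • Measure.dirac ω.1 =
        ENNReal.ofReal (c₀ q) • (C₀ q).measure := by
    intro q
    have h1 : ∑ ω : cycleConfigs k with toOrbit ω = q, ENNReal.ofReal (w ω) • Measure.dirac ω.1 =
        ENNReal.ofReal (w q.out) •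
          ∑ ω : cycleConfigs k with toOrbit ω = toOrbit q.out, Measure.dirac ω.1 := by
      rw [hq, Finset.smul_sum]
      refine Finset.sum_congr rfl fun ω hω => ?_
      rw [Finset.mem_filter, ← hq q, toOrbit_eq_iff] at hω
      rw [apply_eq_of_sameCycle hws hω.2]
    have hlen : ((C₀ q).length : ENNReal) ≠ 0 := by exact_mod_cast (C₀ q).length_pos.ne'
    rw [h1, sum_orbit_eq (C₀ q) (hP _) _ (hPc _) Measure.dirac, ClosedPath.measure, smul_smul, hc₀,
      ENNReal.ofReal_mul (Nat.cast_nonneg _), ENNReal.ofReal_natCast, mul_right_comm,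
      ENNReal.mul_inv_cancel hlen (ENNReal.natCast_ne_top _), one_mul]
  -- Surplus indices receive a dummy loop with coefficient `0`.
  refine ⟨Function.extend e (fun q => C₀ q) fun _ => zeroLoop k,
    Function.extend e (fun q => c₀ q) 0, fun i => ?_, fun i => ?_, ?_⟩
  · by_cases h : ∃ q, e q = i
    · obtain ⟨q, rfl⟩ := h
      rw [e.injective.extend_apply]
      exact hP _
    · rw [Function.extend_apply' _ _ _ h]
      exact zeroLoop_isCycle k
  · by_cases h : ∃ q, e q = i
    · obtain ⟨q, rfl⟩ := h
      rw [e.injective.extend_apply]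
      exact hc₀n _
    · rw [Function.extend_apply' _ _ _ h]
      rfl
  · rw [← Fintype.sum_of_injective e e.injective
      (fun q => ENNReal.ofReal (c₀ q) • (C₀ q).measure) _ (fun i hi => ?_) (fun q => ?_)]
    · rw [Fintype.sum_of_injective Subtype.val Subtype.val_injective _
        (fun q => ENNReal.ofReal (c₀ q) • (C₀ q).measure) (fun q h => ?_) fun q => rfl]
      · simp only [← horbit]
        rw [Finset.sum_fiberwise, weightMeasure, atomicMeasure, Measure.sum_fintype]
      · have h' : ¬ 0 < w q.out := by
          rw [← toOrbit_mem_orbitSupport_iff hws, hq]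
          simpa using h
        have h0 : w q.out = 0 := le_antisymm (not_lt.1 h') (hw _)
        simp [hc₀, h0]
    · rw [Function.extend_apply' _ _ _ (by simpa using hi)]
      simp
    · rw [e.injective.extend_apply, e.injective.extend_apply]

end LTIExtension

theorem mainTheorem3 (k : ℕ) (μk : MeasureTheory.Measure (LTIExtension.LocalConfig k))
    (hprob : MeasureTheory.IsProbabilityMeasure μk) (hLTI : LTIExtension.IsLTI μk) :
    ∃ (C : Fin (2 ^ k + 1) → LTIExtension.ClosedPath k) (c : Fin (2 ^ k + 1) → ℝ)
      (μhat : MeasureTheory.Measure LTIExtension.Config),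
      (∀ i, (C i).IsCycle) ∧ (∀ i, 0 ≤ c i) ∧ ∑ i, c i = 1 ∧
      μhat = ∑ i, ENNReal.ofReal (c i) • (C i).measure ∧
      LTIExtension.IsTIExtension μhat μk ∧
      LTIExtension.totalEntropy μhat < ⊤ ∧
      ∀ μ : MeasureTheory.Measure LTIExtension.Config,
        LTIExtension.IsTIExtension μ μk →
          LTIExtension.totalEntropy μhat ≤ LTIExtension.totalEntropy μ := by
  open LTIExtension in
  obtain ⟨w, hw, hmin, hcard⟩ := exists_minimal_weights hLTI.isCirculation
    fun e => measureReal_nonneg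
  obtain ⟨C, c, hC, hc, heq⟩ := weightMeasure_eq_sum_cycles hw.1 hw.2.1 hcard
  have hext := isTIExtension_weightMeasure hw
  have := hext.isProbabilityMeasure
  have hS := totalEntropy_weightMeasure hw.1 hw.2.1
  refine ⟨C, c, weightMeasure w, hC, hc, ?_, heq, hext, ?_, fun μ hμ => ?_⟩
  -- Each cycle measure has mass one, so the coefficients sum to the total mass.
  · have h := measure_univ (μ := weightMeasure w)
    rw [heq] at h
    simp only [Measure.coe_finsetSum, Finset.sum_apply, Measure.smul_apply,
      ClosedPath.measure_univ, smul_eq_mul, mul_one] at h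
    rwa [← ENNReal.ofReal_sum_of_nonneg fun i _ => hc i, ENNReal.ofReal_eq_one] at h
  · rw [hS]
    exact ENNReal.ofReal_lt_top
  · rcases eq_or_ne (totalEntropy μ) ⊤ with h | h
    · rw [h]
      exact le_top
    · obtain ⟨w', hw', hle⟩ := exists_weights_of_totalEntropy_lt_top hμ (lt_top_iff_ne_top.2 h)
      rw [hS]
      exact (ENNReal.ofReal_le_ofReal (hmin hw')).trans hle
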